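/- Let $S$ be a discrete semigroup. Write $\ell^1(S)$ for its complex convolution algebra, with unit vector basis $(\delta_s)_{s\in S}$, identify $\ell^1(S)^*$ with $\ell^\infty(S)$, and let $\Gamma:\ell^1(S)\to\ell^1(S\times S)$ be the coproduct, the bounded linear map with $\Gamma(\delta_s)=\delta_{(s,s)}$. A \emph{predual} of $\ell^1(S)$ is a closed $\ell^1(S)$-submodule $E\subseteq\ell^\infty(S)$ such that the canonical map $\ell^1(S)\to E^*$, $a\mapsto\langle a,\cdot\rangle|_E$, is an isomorphism of Banach spaces (not necessarily isometric). It is a \emph{Hopf algebra predual} if moreover $\Gamma$ is weak$^*$-continuous, where $\ell^1(S)$ carries the topology $\sigma(\ell^1(S),E)$ and $\ell^1(S\times S)$ carries the topology $\sigma(\ell^1(S\times S),E\check\otimes E)$, with $E\check\otimes E\subseteq\ell^\infty(S\times S)$ the closed linear span of the functions $(s,t)\mapsto f(s)g(t)$ for $f,g\in E$. A Hopf algebra predual is automatically a subalgebra of $\ell^\infty(S)$. Let $E\subseteq\ell^\infty(S)$ be a Hopf algebra predual of $\ell^1(S)$. Then $E$ is a C$^*$-subalgebra of $\ell^\infty(S)$.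 Let $K$ be the character space of $E$ with its weak$^*$ topology. The canonical map $\theta:S\to K$, $\theta(s)(x)=x(s)$ for $x\in E$, is (well defined and) a bijection; use it to turn $K$ into a semigroup. Then: \begin{enumerate} \item $K$ is a semitopological semigroup, that is, its product is separately continuous; \item for each $s\in K$ and each compact $L\subseteq K$, the sets $\{t\in K: st\in L\}$ and $\{t\in K: ts\in L\}$ are compact. \end{enumerate} This structure determines $E$: if $F\subseteq\ell^\infty(S)$ is another Hopf algebra predual of $\ell^1(S)$, with canonical bijection $\varphi$ from $S$ onto its character space $K_F$, and if $\varphi\circ\theta^{-1}:K\to K_F$ is a homeomorphism, then $E=F$. -/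

import Mathlib

open scoped ENNReal Topology

noncomputable section

namespace HopfPredual

/-- The complex Banach space `ℓ¹(S)`. -/
abbrev Ell1 (S : Type*) : Type _ := lp (fun _ : S => ℂ) 1

/-- The commutative C*-algebra `ℓ^∞(S)` of bounded complex functions on `S`, with pointwise
operations and the supremum norm. -/
abbrev EllInf (S : Type*) : Type _ := lp (fun _ : S => ℂ) ∞

/-- The point mass `δ_s`. -/
def delta {S : Type*} (s : S) : Ell1 S := by
  classical exact lp.single 1 s (1 : ℂ)

section Pairing

variable {S : Type*}

theorem summable_norm (a : Ell1 S) : Summable fun s => ‖a s‖ := by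
  simpa using (lp.memℓp a).summable (by simp)

theorem memℓp_one {f : S → ℂ} (hf : Summable fun s => ‖f s‖) : Memℓp f 1 :=
  memℓp_gen (by simpa using hf)

theorem summable_mul (a : Ell1 S) (f : EllInf S) : Summable fun s => a s * f s := by
  refine Summable.of_norm_bounded ((summable_norm a).mul_right ‖f‖) fun s => ?_
  rw [norm_mul]
  exact mul_le_mul_of_nonneg_left (lp.norm_apply_le_norm (by simp) f s) (norm_nonneg _)

/-- The duality `⟨a, f⟩ = ∑ₛ a(s) f(s)` identifying `ℓ^∞(S)` with the dual space of `ℓ¹(S)`. -/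
def pairing : Ell1 S →ₗ[ℂ] EllInf S →ₗ[ℂ] ℂ :=
  LinearMap.mk₂ ℂ (fun a f => ∑' s, a s * f s)
    (fun a b f => by
      rw [← (summable_mul a f).tsum_add (summable_mul b f)]
      simp [add_mul])
    (fun c a f => by
      rw [smul_eq_mul, ← tsum_mul_left]
      simp [mul_assoc])
    (fun a f g => by
      rw [← (summable_mul a f).tsum_add (summable_mul a g)]
      simp [mul_add])
    (fun c a f => by
      rw [smul_eq_mul, ← tsum_mul_left]
      simp [mul_left_comm])

theorem pairing_apply (a : Ell1 S) (f : EllInf S) : pairing a f = ∑' s, a s * f s := rfl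

theorem pairing_delta (s : S) (f : EllInf S) : pairing (delta s) f = f s := by
  classical
  rw [pairing_apply, tsum_eq_single s]
  · simp [delta]
  · intro t ht
    simp [delta, ht]

/-- The topology `σ(ℓ¹(S), E)`: the coarsest topology on `ℓ¹(S)` that makes `a ↦ ⟨a, f⟩`
continuous for every `f ∈ E`. If `E` is a predual, it is the weak* topology. -/
abbrev weakStar (E : Submodule ℂ (EllInf S)) : TopologicalSpace (Ell1 S) :=
  ⨅ f : E, TopologicalSpace.induced (fun a => pairing a (f : EllInf S)) inferInstance

theorem summable_mul_prod (a b : Ell1 S) : Summable fun p : S × S => ‖a p.1 * b p.2‖ := by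
  simpa only [norm_mul] using (summable_norm a).mul_of_nonneg (summable_norm b)
    (fun _ => norm_nonneg _) (fun _ => norm_nonneg _)

end Pairing

section Convolution

variable {S : Type*} [Semigroup S]

/-- The convolution product of `ℓ¹(S)`: `(a * b)(u) = ∑_{st = u} a(s) b(t)`. -/
def conv (a b : Ell1 S) : Ell1 S :=
  ⟨fun u => ∑' p : {p : S × S // p.1 * p.2 = u}, a p.1.1 * b p.1.2, by
    have h : Summable fun q : (Σ u : S, {p : S × S // p.1 * p.2 = u}) =>
        ‖a q.2.1.1 * b q.2.1.2‖ :=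
      (Equiv.sigmaFiberEquiv fun p : S × S => p.1 * p.2).summable_iff.2 (summable_mul_prod a b)
    exact memℓp_one (Summable.of_nonneg_of_le (fun _ => norm_nonneg _)
      (fun u => norm_tsum_le_tsum_norm (h.sigma_factor u)) h.sigma)⟩

theorem conv_delta (s t : S) : conv (delta s) (delta t) = delta (s * t) := by
  classical
  ext u
  change ∑' p : {p : S × S // p.1 * p.2 = u}, delta s p.1.1 * delta t p.1.2 = delta (s * t) u
  by_cases hu : s * t = u
  · rw [tsum_eq_single ⟨(s, t), hu⟩]
    · simp [delta, ← hu]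
    · rintro ⟨⟨x, y⟩, hxy⟩ hne
      by_cases hx : x = s
      · have hy : y ≠ t := fun hy => hne (by subst hx hy; rfl)
        simp [delta, hy]
      · simp [delta, hx]
  · rw [show delta (s * t) u = 0 by simp [delta, Ne.symm hu]]
    refine (tsum_congr ?_).trans tsum_zero
    rintro ⟨⟨x, y⟩, hxy⟩
    by_cases hx : x = s
    · have hy : y ≠ t := fun hy => hu (by subst hx hy; exact hxy)
      simp [delta, hy]
    · simp [delta, hx]

/-- `E ⊆ ℓ^∞(S) = ℓ¹(S)*` is a predual of the Banach algebra `ℓ¹(S)`: a closed subspace which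
is a submodule for the dual actions `⟨b, a • f⟩ = ⟨b * a, f⟩` and `⟨b, f • a⟩ = ⟨a * b, f⟩` of
`ℓ¹(S)`, and for which the canonical map `a ↦ ⟨a, ·⟩` is an isomorphism (not necessarily
isometric) of `ℓ¹(S)` onto the dual Banach space of `E`. -/
structure IsPredual (E : Submodule ℂ (EllInf S)) : Prop where
  isClosed : IsClosed (E : Set (EllInf S))
  left_action : ∀ a : Ell1 S, ∀ f ∈ E, ∃ g ∈ E, ∀ b : Ell1 S, pairing b g = pairing (conv b a) f
  right_action : ∀ a : Ell1 S, ∀ f ∈ E, ∃ g ∈ E, ∀ b : Ell1 S, pairing b g = pairing (conv a b) f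
  isDual : ∃ e : Ell1 S ≃L[ℂ] StrongDual ℂ E,
    ∀ (a : Ell1 S) (f : E), e a f = pairing a (f : EllInf S)

end Convolution

section Coproduct

variable {S : Type*}

theorem diag_injective : Function.Injective fun s : S => (s, s) := fun _ _ h => congrArg Prod.fst h

open Classical in
/-- The coproduct `Γ : ℓ¹(S) → ℓ¹(S × S)`, the bounded linear map with `Γ(δ_s) = δ_(s,s)`. -/
def coproduct (a : Ell1 S) : Ell1 (S × S) :=
  ⟨fun p => if p.1 = p.2 then a p.1 else 0, by
    refine memℓp_one ((diag_injective.summable_iff ?_).1 ?_)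
    · rintro ⟨x, y⟩ hxy
      have : x ≠ y := fun h => hxy ⟨x, by subst h; rfl⟩
      simp [this]
    · simpa [Function.comp_def] using summable_norm a⟩

theorem coproduct_delta (s : S) : coproduct (delta s) = delta (s, s) := by
  classical
  ext ⟨x, y⟩
  change (if x = y then delta s x else 0) = delta (s, s) (x, y)
  by_cases h : x = y
  · subst h
    by_cases hx : x = s
    · subst hx; simp [delta]
    · simp [delta, hx]
  · have : (x, y) ≠ (s, s) := fun e => h (by simp_all)
    simp [delta, h, this]

/-- The elementary tensor `f ⊗ g`, that is `(s, t) ↦ f(s) g(t)`, in `ℓ^∞(S × S)`. -/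
def tmul (f g : EllInf S) : EllInf (S × S) :=
  ⟨fun p => f p.1 * g p.2, by
    refine memℓp_infty ⟨‖f‖ * ‖g‖, ?_⟩
    rintro _ ⟨p, rfl⟩
    simp only [norm_mul]
    exact mul_le_mul (lp.norm_apply_le_norm (by simp) f _) (lp.norm_apply_le_norm (by simp) g _)
      (norm_nonneg _) (norm_nonneg _)⟩

/-- The predual of `ℓ¹(S × S)` obtained from a predual `E` of `ℓ¹(S)`: the closed linear span of
the elementary tensors `f ⊗ g` with `f, g ∈ E` (the injective tensor square of `E`). -/
def tensorSquare (E : Submodule ℂ (EllInf S)) : Submodule ℂ (EllInf (S × S)) :=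
  (Submodule.span ℂ {h | ∃ f ∈ E, ∃ g ∈ E, h = tmul f g}).topologicalClosure

open Classical in
theorem pairing_coproduct (a : Ell1 S) (f g : EllInf S) :
    pairing (coproduct a) (tmul f g) = pairing a (f * g) := by
  rw [pairing_apply, pairing_apply]
  have h := diag_injective.tsum_eq (f := fun p : S × S => coproduct a p * tmul f g p) (by
    rintro ⟨x, y⟩ hxy
    by_contra hne
    have hn : x ≠ y := fun h => hne ⟨x, by subst h; rfl⟩
    refine hxy ?_
    change (if x = y then a x else 0) * tmul f g (x, y) = 0
    simp [hn])
  rw [← h]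
  refine tsum_congr fun s => ?_
  change (if s = s then a s else 0) * (f s * g s) = a s * (f s * g s)
  simp

end Coproduct

section Hopf

variable {S : Type*} [Semigroup S]

/-- A Hopf algebra predual of `ℓ¹(S)`: a predual of the Banach algebra `ℓ¹(S)` (so that the
product is separately weak*-continuous) for which the coproduct is weak*-continuous. -/
structure IsHopfPredual (E : Submodule ℂ (EllInf S)) : Prop extends IsPredual E where
  continuous_coproduct : Continuous[weakStar E, weakStar (tensorSquare E)] coproduct

theorem IsHopfPredual.mul_mem {E : Submodule ℂ (EllInf S)} (hE : IsHopfPredual E)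
    {f g : EllInf S} (hf : f ∈ E) (hg : g ∈ E) : f * g ∈ E := by
  have hfg : tmul f g ∈ tensorSquare E :=
    Submodule.le_topologicalClosure _ (Submodule.subset_span ⟨f, hf, g, hg, rfl⟩)
  have h1 : Continuous[weakStar (tensorSquare E), inferInstance]
      (fun a : Ell1 (S × S) => pairing a (tmul f g)) :=
    continuous_iff_le_induced.2 (iInf_le _ (⟨tmul f g, hfg⟩ : tensorSquare E))
  have h2 : Continuous[weakStar E, inferInstance] (pairing.flip (f * g)) := by
    have := @Continuous.comp _ _ _ (weakStar E) (weakStar (tensorSquare E)) _ _ _ h1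
      hE.continuous_coproduct
    convert this using 1
    ext a
    exact (pairing_coproduct a f g).symm
  have h3 := (LinearMap.mem_span_iff_continuous
    (f := fun x : E => pairing.flip (x : EllInf S)) (pairing.flip (f * g))).2 h2
  have h4 : Submodule.span ℂ (Set.range fun x : E => pairing.flip (x : EllInf S)) ≤
      E.map (pairing (S := S)).flip := by
    rw [Submodule.span_le]
    rintro _ ⟨x, rfl⟩
    exact ⟨x, x.2, rfl⟩
  obtain ⟨x, hx, hxe⟩ := h4 h3
  have : x = f * g := by
    ext s
    have := LinearMap.congr_fun hxe (delta s)
    simpa only [LinearMap.flip_apply, pairing_delta] using this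
  exact this ▸ hx

/-- A Hopf algebra predual, as a (not necessarily unital) subalgebra of `ℓ^∞(S)`. -/
def IsHopfPredual.toSubalgebra {E : Submodule ℂ (EllInf S)} (hE : IsHopfPredual E) :
    NonUnitalSubalgebra ℂ (EllInf S) where
  __ := E
  mul_mem' := hE.mul_mem

/-- The character space of a Hopf algebra predual, with the weak* topology. -/
abbrev IsHopfPredual.characters {E : Submodule ℂ (EllInf S)} (hE : IsHopfPredual E) : Type _ :=
  WeakDual.characterSpace ℂ hE.toSubalgebra

/-- The bijection `θ` from `S` onto the character space is the canonical one: it sends `s` to the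
evaluation at `s`. -/
def IsHopfPredual.IsCanonical {E : Submodule ℂ (EllInf S)} (hE : IsHopfPredual E)
    (θ : S ≃ hE.characters) : Prop :=
  ∀ (s : S) (x : hE.toSubalgebra), θ s x = (x : EllInf S) s

end Hopf

end HopfPredual

end

noncomputable section

namespace HopfPredual

/-! ### Pointwise multiplication on `ℓ¹(S)` and damping of conjugates -/

section Ideal

variable {S : Type*}

/-! Closure under conjugation rests on duality. Given `l` on `ℓ^∞(S)`, each functional `l (g * ·)`
on `E` is represented by some `a g` in `ℓ¹(S)`. As `E` is an algebra, `a` commutes with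
multiplication by `f ∈ E`; a norm approximation extends this to `star f` (`density_star_mul`). If
`l` kills `E` then `a 1 = 0`, so `l` kills `star f * h`, and Hahn–Banach puts `star f * h` in `E`; a
further limit gives `star f ∈ E`.

A character is given by some `a` in `ℓ¹(S)`, and multiplicativity makes `a` an eigenvector of every
multiplication by `g ∈ E`, so it is evaluation at any point of the support of `a`. Translations
preserve `E`, which yields separate continuity; they also carry the compact level sets `|f| ≥ ε` to
sets of the same kind, which yields the compactness statement. Finally, Stone–Weierstrass on the
one-point compactification shows that the topology on `S` determines `E`. -/

theorem memℓp_smul_one (f : EllInf S) (a : Ell1 S) : Memℓp (fun s => f s * a s) 1 := by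
  refine memℓp_one (((summable_norm a).mul_left ‖f‖).of_nonneg_of_le
    (fun _ => norm_nonneg _) fun s => ?_)
  rw [norm_mul]
  gcongr
  exact lp.norm_apply_le_norm (by simp) f s

/-- The action of `ℓ^∞(S)` on `ℓ¹(S)` by pointwise multiplication. -/
def pointwiseMul (f : EllInf S) (a : Ell1 S) : Ell1 S := ⟨fun s => f s * a s, memℓp_smul_one f a⟩

@[simp]
theorem pointwiseMul_apply (f : EllInf S) (a : Ell1 S) (s : S) : pointwiseMul f a s = f s * a s :=
  rfl

theorem pairing_pointwiseMul (f g : EllInf S) (a : Ell1 S) :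
    pairing (pointwiseMul f a) g = pairing a (f * g) := by
  rw [pairing_apply, pairing_apply]
  refine tsum_congr fun s => ?_
  simp only [pointwiseMul_apply, lp.infty_coeFn_mul, Pi.mul_apply]
  ring

/-- The damped functions `u̅ (1 - c |u|²)ⁿ` tend to `0` uniformly, for a suitable `c`. -/
theorem exists_tendsto_star_mul_pow (u : EllInf S) :
    ∃ c : ℂ, Filter.Tendsto (fun n : ℕ => star u * (1 - c • (star u * u)) ^ n) Filter.atTop (𝓝 0) := by
  rcases eq_or_ne u 0 with rfl | hu
  · exact ⟨0, by simp⟩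
  have hM : 0 < ‖u‖ := norm_pos_iff.2 hu
  -- With this `c` and `y = |u s|² / ‖u‖²` in `[0, 1]`, the squared modulus at `s` is `‖u‖² y (1 -
  -- y)^(2n)`, to be bounded by `‖u‖² / n`.
  refine ⟨((‖u‖ ^ 2)⁻¹ : ℝ), ?_⟩
  have hlim : Filter.Tendsto (fun n : ℕ => √(‖u‖ ^ 2 * (n : ℝ)⁻¹)) Filter.atTop (𝓝 0) := by
    have := (tendsto_inv_atTop_nhds_zero_nat (𝕜 := ℝ)).const_mul (‖u‖ ^ 2)
    simpa using this.sqrt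
  refine squeeze_zero_norm' ?_ hlim
  filter_upwards [Filter.eventually_gt_atTop 0] with n hn
  refine lp.norm_le_of_forall_le (Real.sqrt_nonneg _) fun s => Real.le_sqrt_of_sq_le ?_
  set y : ℝ := ‖u s‖ ^ 2 / ‖u‖ ^ 2 with hy
  have hus : ‖u s‖ ≤ ‖u‖ := lp.norm_apply_le_norm (by simp) u s
  have hy0 : 0 ≤ y := by positivity
  have hy1 : y ≤ 1 := div_le_one_of_le₀ (by gcongr) (by positivity)
  have hval : (star u * (1 - (((‖u‖ ^ 2)⁻¹ : ℝ) : ℂ) • (star u * u)) ^ n) s =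
      star (u s) * ((1 - y : ℝ) : ℂ) ^ n := by
    have h1 : star (u s) * u s = ((‖u s‖ ^ 2 : ℝ) : ℂ) := by
      simpa using Complex.conj_mul' (u s)
    simp only [lp.infty_coeFn_mul, lp.infty_coeFn_pow, lp.coeFn_sub, lp.infty_coeFn_one,
      lp.coeFn_smul, lp.coeFn_star, Pi.mul_apply, Pi.pow_apply, Pi.sub_apply, Pi.one_apply,
      Pi.smul_apply, Pi.star_apply, h1, smul_eq_mul]
    rw [hy]
    push_cast
    ring
  rw [hval, norm_mul, norm_star, norm_pow, Complex.norm_real, Real.norm_eq_abs,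
    abs_of_nonneg (sub_nonneg.2 hy1), mul_pow]
  have hyu : ‖u s‖ ^ 2 = ‖u‖ ^ 2 * y := by rw [hy]; field_simp
  rw [hyu, mul_assoc]
  gcongr
  -- Bernoulli's inequality gives `n y (1 - y)^n ≤ 1`, uniformly in `s`.
  have h1 : (1 + n * y) * (1 - y) ^ n ≤ 1 := by
    calc (1 + n * y) * (1 - y) ^ n ≤ (1 + y) ^ n * (1 - y) ^ n := by
          have := one_add_mul_le_pow (a := y) (by linarith) n
          have : 0 ≤ (1 - y) ^ n := pow_nonneg (sub_nonneg.2 hy1) n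
          gcongr
      _ = (1 - y ^ 2) ^ n := by rw [← mul_pow]; ring
      _ ≤ 1 := pow_le_one₀ (by nlinarith) (by nlinarith)
  have h2 : ((1 - y) ^ n) ^ 2 ≤ (1 - y) ^ n := by
    have h3 : 0 ≤ (1 - y) ^ n := pow_nonneg (sub_nonneg.2 hy1) n
    have h4 : (1 - y) ^ n ≤ 1 := pow_le_one₀ (sub_nonneg.2 hy1) (by linarith)
    nlinarith
  have hn' : (0 : ℝ) < n := by exact_mod_cast hn
  rw [← one_div, le_div_iff₀ hn']
  have h3 : 0 ≤ (1 - y) ^ n := pow_nonneg (sub_nonneg.2 hy1) n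
  nlinarith [mul_le_mul_of_nonneg_left h2 (mul_nonneg hy0 hn'.le)]

end Ideal

/-- A vector outside a closed subspace is detected by a functional vanishing on the subspace. -/
theorem mem_of_forall_dual {X : Type*} [NormedAddCommGroup X] [NormedSpace ℂ X] {V : Submodule ℂ X}
    (hV : IsClosed (V : Set X)) {x : X} (h : ∀ l : StrongDual ℂ X, (∀ v ∈ V, l v = 0) → l x = 0) :
    x ∈ V := by
  have : IsClosed (V : Set X) := hV
  by_contra hx
  obtain ⟨l, -, hl⟩ := exists_dual_vector ℂ (V.mkQ x) (norm_ne_zero_iff.2 (by simpa using hx))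
  have h0 := h (l.comp V.mkQL) fun v hv => by
    have : V.mkQ v = 0 := by simpa using hv
    change l (V.mkQ v) = 0
    rw [this, map_zero]
  change l (V.mkQ x) = 0 at h0
  rw [h0] at hl
  refine hx ((Submodule.Quotient.mk_eq_zero V).1 (norm_eq_zero.1 ?_))
  exact RCLike.ofReal_eq_zero.1 hl.symm

/-! ### Closure under conjugation -/

section Star

variable {S : Type*} [Semigroup S] {E : Submodule ℂ (EllInf S)}

theorem IsPredual.eq_zero (hE : IsPredual E) {a : Ell1 S} (h : ∀ f ∈ E, pairing a f = 0) :
    a = 0 := by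
  obtain ⟨e, he⟩ := hE.isDual
  refine e.injective ?_
  ext f
  rw [he, h f f.2]
  simp

theorem IsPredual.exists_pairing (hE : IsPredual E) (l : StrongDual ℂ E) :
    ∃ a : Ell1 S, ∀ f : E, l f = pairing a (f : EllInf S) := by
  obtain ⟨e, he⟩ := hE.isDual
  exact ⟨e.symm l, fun f => by rw [← he, e.apply_symm_apply]⟩

/-- A functional `l` on `ℓ^∞(S)` gives a bounded family `a g ∈ ℓ¹(S)` representing the functionals
`l (g * ·)` on a predual. -/
theorem IsPredual.exists_density (hE : IsPredual E) (l : StrongDual ℂ (EllInf S)) :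
    ∃ a : EllInf S →L[ℂ] Ell1 S, ∀ g, ∀ h ∈ E, pairing (a g) h = l (g * h) := by
  obtain ⟨e, he⟩ := hE.isDual
  let T : EllInf S →L[ℂ] StrongDual ℂ E :=
    LinearMap.mkContinuous₂ (LinearMap.mk₂ ℂ (fun (g : EllInf S) (h : E) => l (g * h))
      (fun _ _ _ => by simp [add_mul]) (fun c g h => by rw [smul_mul_assoc, map_smul])
      (fun _ _ _ => by simp [mul_add])
      (fun c g h => by rw [Submodule.coe_smul, mul_smul_comm, map_smul])) ‖l‖ fun g h => by
        rw [mul_assoc]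
        exact l.le_opNorm_of_le (norm_mul_le g h)
  refine ⟨(e.symm : StrongDual ℂ E →L[ℂ] Ell1 S).comp T, fun g h hh => ?_⟩
  rw [← he _ ⟨h, hh⟩]
  simp [T]

/-- Since `f * h ∈ E`, both sides pair with `h ∈ E` to `l (f * g * h)`, and `E` separates `ℓ¹(S)`.
-/
theorem IsHopfPredual.density_mul (hE : IsHopfPredual E) {l : StrongDual ℂ (EllInf S)}
    {a : EllInf S →L[ℂ] Ell1 S} (ha : ∀ g, ∀ h ∈ E, pairing (a g) h = l (g * h))
    {f : EllInf S} (hf : f ∈ E) (g : EllInf S) : a (f * g) = pointwiseMul f (a g) := by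
  refine sub_eq_zero.1 (hE.eq_zero fun h hh => ?_)
  rw [map_sub, LinearMap.sub_apply, ha _ h hh, pairing_pointwiseMul, ha g _ (hE.mul_mem hf hh),
    sub_eq_zero]
  ring_nf

/-- Work at one point `s`. The coordinate `a (·) s` kills multiples of `u = f - f s • 1`, and `star
u` is a norm limit of multiples of `u`, so it kills multiples of `star u` too. -/
theorem IsHopfPredual.density_star_mul (hE : IsHopfPredual E) {l : StrongDual ℂ (EllInf S)}
    {a : EllInf S →L[ℂ] Ell1 S} (ha : ∀ g, ∀ h ∈ E, pairing (a g) h = l (g * h))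
    {f : EllInf S} (hf : f ∈ E) (g : EllInf S) : a (star f * g) = pointwiseMul (star f) (a g) := by
  ext s
  set u : EllInf S := f - f s • 1 with hu
  have hmul : ∀ x, a (u * x) s = 0 := fun x => by
    rw [hu, sub_mul, map_sub, smul_mul_assoc, one_mul, map_smul, hE.density_mul ha hf]
    exact sub_self (f s * a x s)
  obtain ⟨c, hc⟩ := exists_tendsto_star_mul_pow u
  have hconst : ∀ n : ℕ, a (star u * (1 - c • (star u * u)) ^ n * g) s = a (star u * g) s := by
    intro n
    -- Damping alters `star u * g` only by a multiple of `u`, which is invisible at `s`.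
    have hdvd : u ∣ 1 - (1 - c • (star u * u)) ^ n := by
      have h1 := sub_dvd_pow_sub_pow (1 : EllInf S) (1 - c • (star u * u)) n
      rw [one_pow, sub_sub_cancel] at h1
      exact (Dvd.intro_left (c • star u) (by rw [smul_mul_assoc])).trans h1
    obtain ⟨z, hz⟩ := hdvd
    have h2 : star u * (1 - c • (star u * u)) ^ n * g = star u * g - u * (z * star u * g) := by
      rw [show (1 - c • (star u * u)) ^ n = 1 - u * z by rw [← hz, sub_sub_cancel]]
      ring
    rw [h2, map_sub, lp.coeFn_sub, Pi.sub_apply, hmul, sub_zero]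
  have hzero : a (star u * g) s = 0 := by
    have h1 : Filter.Tendsto (fun n : ℕ => a (star u * (1 - c • (star u * u)) ^ n * g) s)
        Filter.atTop (𝓝 0) := by
      have hcont : Continuous fun x : EllInf S => a (x * g) s :=
        (lp.evalCLM ℂ (fun _ : S => ℂ) 1 s).continuous.comp
          (a.continuous.comp (continuous_id.mul continuous_const))
      simpa [Function.comp_def] using (hcont.tendsto 0).comp hc
    simp only [hconst] at h1
    exact tendsto_nhds_unique tendsto_const_nhds h1
  have hstar : star f * g = star u * g + star (f s) • g := by
    rw [hu, star_sub, star_smul, star_one, sub_mul, smul_mul_assoc, one_mul, sub_add_cancel]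
  rw [hstar, map_add, lp.coeFn_add, Pi.add_apply, hzero, map_smul]
  simp

/-- The conjugates of a Hopf algebra predual multiply it into itself. -/
theorem IsHopfPredual.star_mul_mem (hE : IsHopfPredual E) {f h : EllInf S} (hf : f ∈ E)
    (hh : h ∈ E) : star f * h ∈ E := by
  refine mem_of_forall_dual hE.isClosed fun l hl => ?_
  obtain ⟨a, ha⟩ := hE.exists_density l
  -- Here it matters that `a` is defined on all of `ℓ^∞(S)`: neither `1` nor `star f` is known to
  -- lie in `E`.
  have h1 : a 1 = 0 := hE.eq_zero fun k hk => by rw [ha 1 k hk, one_mul, hl k hk]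
  have h2 := hE.density_star_mul ha hf 1
  rw [← ha _ h hh, ← mul_one (star f), h2, pairing_pointwiseMul, h1]
  simp

theorem IsHopfPredual.star_mem (hE : IsHopfPredual E) {f : EllInf S} (hf : f ∈ E) :
    star f ∈ E := by
  obtain ⟨c, hc⟩ := exists_tendsto_star_mul_pow f
  set p : EllInf S := c • (star f * f) with hp
  have hpE : p ∈ E := E.smul_mem c (hE.star_mul_mem hf hf)
  -- The constants cancel: this difference is a sum of terms `star f * p ^ k` with `k ≥ 1`.
  have hmem : ∀ n : ℕ, star f - star f * (1 - p) ^ n ∈ E := by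
    intro n
    induction n with
    | zero => simp
    | succ n ih =>
      have : star f - star f * (1 - p) ^ (n + 1) = (star f - star f * (1 - p) ^ n) +
          (star f * p - (star f - star f * (1 - p) ^ n) * p) := by ring
      rw [this]
      exact E.add_mem ih (E.sub_mem (hE.star_mul_mem hf hpE) (hE.mul_mem ih hpE))
  have hlim := (tendsto_const_nhds (x := star f)).sub hc
  rw [sub_zero] at hlim
  exact hE.isClosed.mem_of_tendsto hlim (Filter.Eventually.of_forall hmem)

end Star

end HopfPredual

/-! ### Characters as point evaluations, and the topology of the character space -/

namespace HopfPredual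

variable {S : Type*} [Semigroup S] {E : Submodule ℂ (EllInf S)}

theorem IsPredual.exists_apply_ne_zero (hE : IsPredual E) (s : S) : ∃ f ∈ E, f s ≠ 0 := by
  by_contra! h
  have h0 : delta s = 0 := hE.eq_zero fun f hf => by rw [pairing_delta, h f hf]
  have h1 := congrArg (fun a : Ell1 S => pairing a 1) h0
  simp [pairing_delta] at h1

theorem IsPredual.exists_apply_ne (hE : IsPredual E) {s t : S} (hst : s ≠ t) :
    ∃ f ∈ E, f s ≠ f t := by
  classical
  by_contra! h
  have h0 : delta s - delta t = 0 := hE.eq_zero fun f hf => by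
    rw [map_sub, LinearMap.sub_apply, pairing_delta, pairing_delta, h f hf, sub_self]
  have h1 := congrArg (fun a : Ell1 S => a s) (sub_eq_zero.1 h0)
  simp [delta, hst] at h1

/-- Convolving on the left by `δ_s` is dual to the right module action, whence the exchange of
sides. -/
theorem IsPredual.left_translate_mem (hE : IsPredual E) (s : S) {f : EllInf S} (hf : f ∈ E) :
    ∃ g ∈ E, ∀ t, g t = f (s * t) := by
  obtain ⟨g, hg, h⟩ := hE.right_action (delta s) f hf
  exact ⟨g, hg, fun t => by simpa [conv_delta, pairing_delta] using h (delta t)⟩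

theorem IsPredual.right_translate_mem (hE : IsPredual E) (s : S) {f : EllInf S} (hf : f ∈ E) :
    ∃ g ∈ E, ∀ t, g t = f (t * s) := by
  obtain ⟨g, hg, h⟩ := hE.left_action (delta s) f hf
  exact ⟨g, hg, fun t => by simpa [conv_delta, pairing_delta] using h (delta t)⟩

/-- Evaluation at a point, as a character of a Hopf algebra predual. -/
def IsHopfPredual.evalCharacter (hE : IsHopfPredual E) (s : S) : hE.characters :=
  ⟨(⟨{ toFun := fun x => (x : EllInf S) s
       map_add' := fun _ _ => rfl
       map_smul' := fun _ _ => rfl },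
      (lp.evalCLM ℂ (fun _ : S => ℂ) ∞ s).continuous.comp continuous_subtype_val⟩ :
      hE.toSubalgebra →L[ℂ] ℂ), by
    refine ⟨fun h => ?_, fun _ _ => rfl⟩
    obtain ⟨f, hf, hfs⟩ := hE.exists_apply_ne_zero s
    exact hfs (DFunLike.congr_fun h (⟨f, hf⟩ : hE.toSubalgebra))⟩

@[simp]
theorem IsHopfPredual.evalCharacter_apply (hE : IsHopfPredual E) (s : S) (x : hE.toSubalgebra) :
    hE.evalCharacter s x = (x : EllInf S) s := rfl

theorem IsHopfPredual.evalCharacter_injective (hE : IsHopfPredual E) :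
    Function.Injective hE.evalCharacter := by
  intro s t h
  by_contra hst
  obtain ⟨f, hf, hne⟩ := hE.exists_apply_ne hst
  exact hne (DFunLike.congr_fun h (⟨f, hf⟩ : hE.toSubalgebra))

theorem IsHopfPredual.evalCharacter_surjective (hE : IsHopfPredual E) :
    Function.Surjective hE.evalCharacter := by
  intro χ
  let l : StrongDual ℂ E :=
    ⟨{ toFun := fun f => χ (⟨f.1, f.2⟩ : hE.toSubalgebra)
       map_add' := fun f g => χ.1.map_add' (⟨f.1, f.2⟩ : hE.toSubalgebra) ⟨g.1, g.2⟩
       map_smul' := fun c f => χ.1.map_smul' c (⟨f.1, f.2⟩ : hE.toSubalgebra) },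
      (map_continuous χ).comp (continuous_subtype_val.subtype_mk _)⟩
  obtain ⟨a, ha⟩ := hE.exists_pairing l
  have ha' : ∀ (f : EllInf S) (hf : f ∈ E), χ (⟨f, hf⟩ : hE.toSubalgebra) = pairing a f :=
    fun f hf => ha ⟨f, hf⟩
  -- Multiplicativity of `χ` says that `g · a` and `χ(g) a` define the same functional on `E`.
  have hmul : ∀ g ∈ E, pointwiseMul g a - pairing a g • a = 0 := fun g hg =>
    hE.eq_zero fun f hf => by
      rw [map_sub, map_smul, LinearMap.sub_apply, LinearMap.smul_apply, pairing_pointwiseMul,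
        ← ha' _ (hE.mul_mem hg hf), ← ha' g hg, ← ha' f hf, sub_eq_zero, smul_eq_mul, ← map_mul]
      rfl
  obtain ⟨s, hs⟩ : ∃ s, a s ≠ 0 := by
    by_contra! h
    have h0 : a = 0 := by ext s; exact h s
    refine χ.2.1 (ContinuousLinearMap.ext fun x => ?_)
    exact (ha' x.1 x.2).trans ((congrArg (pairing · x.1) h0).trans (by simp; rfl))
  refine ⟨s, WeakDual.CharacterSpace.ext fun x => ?_⟩
  have h1 := congrArg (fun b : Ell1 S => b s) (hmul x.1 x.2)
  have h2 : (x : EllInf S) s * a s - pairing a x.1 * a s = 0 := h1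
  rw [hE.evalCharacter_apply, ← Subtype.coe_eta x x.2, ha' x.1 x.2]
  exact mul_right_cancel₀ hs (sub_eq_zero.1 h2)

theorem IsHopfPredual.exists_isCanonical (hE : IsHopfPredual E) :
    ∃ θ : S ≃ hE.characters, hE.IsCanonical θ :=
  ⟨Equiv.ofBijective _ ⟨hE.evalCharacter_injective, hE.evalCharacter_surjective⟩,
    fun _ _ => rfl⟩

namespace IsHopfPredual.IsCanonical

variable {hE : IsHopfPredual E} {θ : S ≃ hE.characters}

theorem apply_symm (hθ : hE.IsCanonical θ) (χ : hE.characters) (x : hE.toSubalgebra) :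
    (x : EllInf S) (θ.symm χ) = χ x := by
  rw [← hθ, θ.apply_symm_apply]

theorem continuous_apply_symm (hθ : hE.IsCanonical θ) {f : EllInf S} (hf : f ∈ E) :
    Continuous fun χ => f (θ.symm χ) := by
  have : (fun χ => f (θ.symm χ)) = fun χ => χ (⟨f, hf⟩ : hE.toSubalgebra) :=
    funext fun χ => hθ.apply_symm χ ⟨f, hf⟩
  rw [this]
  exact (WeakDual.eval_continuous _).comp continuous_subtype_val

theorem continuous_of_forall (hθ : hE.IsCanonical θ) {X : Type*} [TopologicalSpace X]
    {F : X → hE.characters} (h : ∀ f ∈ E, Continuous fun x => f (θ.symm (F x))) :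
    Continuous F := by
  refine Continuous.subtype_mk (f := fun x => (F x : WeakDual ℂ hE.toSubalgebra))
    (WeakDual.continuous_of_continuous_eval fun y => ?_) fun x => (F x).2
  have : (fun x => F x y) = fun x => (y : EllInf S) (θ.symm (F x)) :=
    funext fun x => (hθ.apply_symm (F x) y).symm
  exact this ▸ h y.1 y.2

set_option synthInstance.maxHeartbeats 200000 in
/-- Functions in a Hopf algebra predual vanish at infinity on the character space. -/
theorem isCompact_le_norm (hθ : hE.IsCanonical θ) {f : EllInf S} (hf : f ∈ E) {ε : ℝ}
    (hε : 0 < ε) : IsCompact {χ | ε ≤ ‖f (θ.symm χ)‖} := by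
  let : NormedSpace ℂ hE.toSubalgebra := ⟨fun c x => norm_smul_le c (x : EllInf S)⟩
  rw [Subtype.isCompact_iff]
  let y : hE.toSubalgebra := ⟨f, hf⟩
  -- Only the characters together with `0` are known to be weak*-closed; the bound by `ε > 0`
  -- excludes `0`, and Banach–Alaoglu applies.
  have himage : (Subtype.val '' {χ : hE.characters | ε ≤ ‖f (θ.symm χ)‖}) =
      (WeakDual.characterSpace ℂ hE.toSubalgebra ∪ {0}) ∩ {φ | ε ≤ ‖φ y‖} := by
    ext φ
    constructor
    · rintro ⟨χ, hχ, rfl⟩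
      refine ⟨Or.inl χ.2, ?_⟩
      have := hθ.apply_symm χ y
      simpa [← this, y] using! hχ
    · rintro ⟨hφ | hφ, h⟩
      · refine ⟨⟨φ, hφ⟩, ?_, rfl⟩
        have := hθ.apply_symm ⟨φ, hφ⟩ y
        change ε ≤ ‖(y : EllInf S) (θ.symm ⟨φ, hφ⟩)‖
        rw [this]
        exact h
      · rw [Set.mem_singleton_iff] at hφ
        subst hφ
        replace h : ε ≤ ‖(0 : ℂ)‖ := h
        rw [norm_zero] at h
        exact absurd h (not_le.2 hε)
  refine (WeakDual.isCompact_closedBall (𝕜 := ℂ) (E := hE.toSubalgebra) 0 1).of_isClosed_subset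
    ?_ ?_
  · rw [himage]
    exact (WeakDual.CharacterSpace.union_zero_isClosed ℂ hE.toSubalgebra).inter
      (isClosed_le continuous_const (WeakDual.eval_continuous y).norm)
  · rintro _ ⟨χ, -, rfl⟩
    rw [Set.mem_preimage, mem_closedBall_zero_iff]
    refine ContinuousLinearMap.opNorm_le_bound _ zero_le_one fun x => ?_
    change ‖χ x‖ ≤ _
    rw [← hθ.apply_symm, one_mul]
    exact lp.norm_apply_le_norm (by simp) (x : EllInf S) _

theorem separatelyContinuousMul (hθ : hE.IsCanonical θ) :
    letI : Semigroup hE.characters := θ.symm.semigroup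
    SeparatelyContinuousMul hE.characters := by
  let : Semigroup hE.characters := θ.symm.semigroup
  refine ⟨fun {χ} => hθ.continuous_of_forall fun f hf => ?_,
    fun {χ} => hθ.continuous_of_forall fun f hf => ?_⟩
  · obtain ⟨g, hg, h⟩ := hE.left_translate_mem (θ.symm χ) hf
    convert hθ.continuous_apply_symm hg using 2 with ψ
    rw [h, Equiv.mul_def, Equiv.symm_symm, Equiv.symm_apply_apply]
  · obtain ⟨g, hg, h⟩ := hE.right_translate_mem (θ.symm χ) hf
    convert hθ.continuous_apply_symm hg using 2 with ψ
    rw [h, Equiv.mul_def, Equiv.symm_symm, Equiv.symm_apply_apply]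

/-- Compact sets of characters are covered by finitely many level sets `|f| ≥ ε`; pulling these
back along a map that preserves `E` gives compact sets. -/
theorem isCompact_preimage (hθ : hE.IsCanonical θ) {T : hE.characters → hE.characters}
    (hT : ∀ f ∈ E, ∃ g ∈ E, ∀ χ, g (θ.symm χ) = f (θ.symm (T χ))) {L : Set hE.characters}
    (hL : IsCompact L) : IsCompact (T ⁻¹' L) := by
  have hTc : Continuous T := hθ.continuous_of_forall fun f hf => by
    obtain ⟨g, hg, h⟩ := hT f hf
    simpa only [h] using hθ.continuous_apply_symm hg
  refine hL.induction_on (p := fun K => ∃ C, IsCompact C ∧ T ⁻¹' K ⊆ C) ?_ ?_ ?_ ?_ |>.elim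
    fun C hC => hC.1.of_isClosed_subset (hL.isClosed.preimage hTc) hC.2
  · exact ⟨∅, isCompact_empty, by simp⟩
  · rintro K K' hK ⟨C, hC, h⟩
    exact ⟨C, hC, (Set.preimage_mono hK).trans h⟩
  · rintro K K' ⟨C, hC, h⟩ ⟨C', hC', h'⟩
    exact ⟨C ∪ C', hC.union hC', Set.union_subset_union h h'⟩
  · intro χ _
    obtain ⟨f, hf, hne⟩ := hE.exists_apply_ne_zero (θ.symm χ)
    obtain ⟨g, hg, h⟩ := hT f hf
    have hpos : 0 < ‖f (θ.symm χ)‖ := norm_pos_iff.2 hne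
    -- Halving the value at `χ` makes the level set a neighbourhood of `χ`.
    refine ⟨{ψ | ‖f (θ.symm χ)‖ / 2 ≤ ‖f (θ.symm ψ)‖}, mem_nhdsWithin_of_mem_nhds ?_,
      {ψ | ‖f (θ.symm χ)‖ / 2 ≤ ‖g (θ.symm ψ)‖}, hθ.isCompact_le_norm hg (half_pos hpos),
      fun ψ hψ => by simpa [h] using hψ⟩
    filter_upwards [(hθ.continuous_apply_symm hf).norm.continuousAt.eventually
      (lt_mem_nhds (half_lt_self hpos))] with ψ hψ using le_of_lt hψ

theorem isCompact_preimage_mul (hθ : hE.IsCanonical θ) (χ : hE.characters)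
    {L : Set hE.characters} (hL : IsCompact L) :
    letI : Semigroup hE.characters := θ.symm.semigroup
    IsCompact {ψ | χ * ψ ∈ L} ∧ IsCompact {ψ | ψ * χ ∈ L} := by
  let : Semigroup hE.characters := θ.symm.semigroup
  constructor
  · refine hθ.isCompact_preimage (T := fun ψ => χ * ψ) (fun f hf => ?_) hL
    obtain ⟨g, hg, h⟩ := hE.left_translate_mem (θ.symm χ) hf
    exact ⟨g, hg, fun ψ => by rw [h, Equiv.mul_def, Equiv.symm_symm, Equiv.symm_apply_apply]⟩
  · refine hθ.isCompact_preimage (T := fun ψ => ψ * χ) (fun f hf => ?_) hL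
    obtain ⟨g, hg, h⟩ := hE.right_translate_mem (θ.symm χ) hf
    exact ⟨g, hg, fun ψ => by rw [h, Equiv.mul_def, Equiv.symm_symm, Equiv.symm_apply_apply]⟩

end IsHopfPredual.IsCanonical

end HopfPredual

/-! ### Recovering the predual from the topology -/

namespace HopfPredual

variable {S : Type*} [Semigroup S] {E F : Submodule ℂ (EllInf S)}

/-- The functions `h + c` with `h` in a Hopf algebra predual and `c` constant, as a star subalgebra
of the continuous functions on the one-point compactification of the character space. -/
def IsHopfPredual.unitization (hF : IsHopfPredual F) (φ : S ≃ hF.characters) :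
    StarSubalgebra ℂ C(OnePoint hF.characters, ℂ) where
  carrier := {k | ∃ h ∈ F, ∀ χ : hF.characters, k χ = h (φ.symm χ) + k OnePoint.infty}
  mul_mem' := by
    rintro k k' ⟨h, hh, hk⟩ ⟨h', hh', hk'⟩
    refine ⟨h * h' + k' OnePoint.infty • h + k OnePoint.infty • h',
      F.add_mem (F.add_mem (hF.mul_mem hh hh') (F.smul_mem _ hh)) (F.smul_mem _ hh'), fun χ => ?_⟩
    simp only [ContinuousMap.mul_apply, hk χ, hk' χ]
    change _ = h _ * h' _ + _ * h _ + _ * h' _ + _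
    ring
  add_mem' := by
    rintro k k' ⟨h, hh, hk⟩ ⟨h', hh', hk'⟩
    refine ⟨h + h', F.add_mem hh hh', fun χ => ?_⟩
    simp only [ContinuousMap.add_apply, hk χ, hk' χ]
    change _ = h _ + h' _ + _
    ring
  algebraMap_mem' c := ⟨0, F.zero_mem, fun χ => by simp⟩
  star_mem' := by
    rintro k ⟨h, hh, hk⟩
    refine ⟨star h, hF.star_mem hh, fun χ => ?_⟩
    simp only [ContinuousMap.star_apply, hk χ, star_add]
    rfl

namespace IsHopfPredual.IsCanonical

variable {hE : IsHopfPredual E} {θ : S ≃ hE.characters}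
  {hF : IsHopfPredual F} {φ : S ≃ hF.characters}

set_option synthInstance.maxHeartbeats 200000 in
theorem tendsto_coclosedCompact (hE' : hE.IsCanonical θ) (ψ : hF.characters ≃ₜ hE.characters)
    {f : EllInf S} (hf : f ∈ E) :
    Filter.Tendsto (fun χ => f (θ.symm (ψ χ))) (Filter.coclosedCompact hF.characters) (𝓝 0) := by
  rw [Filter.coclosedCompact_eq_cocompact, Metric.tendsto_nhds]
  intro ε hε
  have hK := ψ.isCompact_preimage.2 (hE'.isCompact_le_norm hf hε)
  filter_upwards [hK.compl_mem_cocompact] with χ hχ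
  simpa using hχ

theorem exists_mem_unitization (hφ : hF.IsCanonical φ) {h : EllInf S} (hh : h ∈ F) :
    ∃ k ∈ hF.unitization φ, k OnePoint.infty = 0 ∧
      ∀ χ : hF.characters, k χ = h (φ.symm χ) := by
  let k := OnePoint.continuousMapMk ⟨_, hφ.continuous_apply_symm hh⟩ 0
    (hφ.tendsto_coclosedCompact (Homeomorph.refl _) hh)
  exact ⟨k, ⟨h, hh, fun χ => (add_zero _).symm⟩, rfl, fun χ => rfl⟩

theorem unitization_separatesPoints (hφ : hF.IsCanonical φ) :
    (hF.unitization φ).SeparatesPoints := by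
  have hsep : ∀ {h : EllInf S} (_ : h ∈ F) {x y : OnePoint hF.characters},
      (∀ k ∈ hF.unitization φ, k OnePoint.infty = 0 →
        (∀ χ : hF.characters, k χ = h (φ.symm χ)) → k x ≠ k y) →
      ∃ f ∈ ((fun f : C(OnePoint hF.characters, ℂ) => (f : OnePoint hF.characters → ℂ)) ''
        (hF.unitization φ : Set C(OnePoint hF.characters, ℂ))), f x ≠ f y := by
    intro h hh x y hxy
    obtain ⟨k, hk, h0, hkh⟩ := hφ.exists_mem_unitization hh
    exact ⟨k, ⟨k, hk, rfl⟩, hxy k hk h0 hkh⟩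
  intro x y hxy
  induction x with
  | infty =>
    induction y with
    | infty => exact absurd rfl hxy
    | coe y =>
      obtain ⟨h, hh, hne⟩ := hF.exists_apply_ne_zero (φ.symm y)
      exact hsep hh fun k _ h0 hk => by rw [h0, hk]; exact hne.symm
  | coe x =>
    induction y with
    | infty =>
      obtain ⟨h, hh, hne⟩ := hF.exists_apply_ne_zero (φ.symm x)
      exact hsep hh fun k _ h0 hk => by rw [h0, hk]; exact hne
    | coe y =>
      obtain ⟨h, hh, hne⟩ := hF.exists_apply_ne
        (s := φ.symm x) (t := φ.symm y) fun e => hxy (congrArg _ (φ.symm.injective e))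
      exact hsep hh fun k _ _ hk => by rw [hk, hk]; exact hne

set_option synthInstance.maxHeartbeats 200000 in
-- Transported to the characters of `F`, `f` is continuous and vanishes at infinity, so
-- Stone–Weierstrass approximates it by elements of `F` plus constants.
theorem le_of_homeomorph (hθ : hE.IsCanonical θ) (hφ : hF.IsCanonical φ)
    (ψ : hF.characters ≃ₜ hE.characters) (hψ : ∀ s, ψ (φ s) = θ s) : E ≤ F := by
  intro f hf
  let k := OnePoint.continuousMapMk
    ⟨fun χ => f (θ.symm (ψ χ)), (hθ.continuous_apply_symm hf).comp ψ.continuous⟩ 0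
    (hθ.tendsto_coclosedCompact ψ hf)
  have hkf : ∀ s, k (φ s : hF.characters) = f s := fun s => by
    change f (θ.symm (ψ (φ s))) = f s
    rw [hψ, θ.symm_apply_apply]
  have hk : k ∈ (hF.unitization φ).topologicalClosure := by
    rw [ContinuousMap.starSubalgebra_topologicalClosure_eq_top_of_separatesPoints _
      hφ.unitization_separatesPoints]
    trivial
  have hcl : IsClosed (F : Set (EllInf S)) := hF.isClosed
  change f ∈ (F : Set (EllInf S))
  rw [← hcl.closure_eq, Metric.mem_closure_iff]
  intro ε hε
  -- As `k` vanishes at infinity, the constant part of `k'` is at most `ε / 3`; dropping it leaves a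
  -- total error of at most `2ε / 3`.
  obtain ⟨k', ⟨h, hh, hkh⟩, hd⟩ := Metric.mem_closure_iff.1 hk (ε / 3) (by positivity)
  refine ⟨h, hh, ?_⟩
  have hb : ∀ x, ‖k x - k' x‖ ≤ ε / 3 := fun x => by
    rw [← dist_eq_norm]
    exact (ContinuousMap.dist_apply_le_dist x).trans hd.le
  have h0 : ‖k' OnePoint.infty‖ ≤ ε / 3 := by
    have : k OnePoint.infty = 0 := rfl
    simpa [this] using hb OnePoint.infty
  rw [dist_eq_norm]
  refine (lp.norm_le_of_forall_le (C := ε / 3 + ε / 3) (by positivity) fun s => ?_).trans_lt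
    (by linarith)
  have h1 : (f - h) s = (k (φ s : hF.characters) - k' (φ s : hF.characters)) +
      k' OnePoint.infty := by
    rw [hkf, hkh, φ.symm_apply_apply, lp.coeFn_sub, Pi.sub_apply]
    ring
  rw [h1]
  exact (norm_add_le _ _).trans (add_le_add (hb _) h0)

theorem eq_of_isHomeomorph (hθ : hE.IsCanonical θ) (hφ : hF.IsCanonical φ)
    (h : IsHomeomorph (θ.symm.trans φ)) : E = F := by
  let ψ : hE.characters ≃ₜ hF.characters := (θ.symm.trans φ).toHomeomorphOfIsInducing h.isInducing
  refine le_antisymm (hθ.le_of_homeomorph hφ ψ.symm fun s => ?_)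
    (hφ.le_of_homeomorph hθ ψ fun s => ?_)
  · rw [ψ.symm_apply_eq]
    exact congrArg φ (θ.symm_apply_apply s).symm
  · exact congrArg φ (θ.symm_apply_apply s)

end IsHopfPredual.IsCanonical

end HopfPredual

end

theorem mainTheorem3 {S : Type*} [Semigroup S]
    (E : Submodule ℂ (HopfPredual.EllInf S)) (hE : HopfPredual.IsHopfPredual E) :
    -- `E` is a C*-subalgebra of `ℓ^∞(S)`
    (∃ A : NonUnitalStarSubalgebra ℂ (HopfPredual.EllInf S),
      (A : Set (HopfPredual.EllInf S)) = E ∧ IsClosed (A : Set (HopfPredual.EllInf S))) ∧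
    -- the canonical bijection between `S` and the character space
    ∃ θ : S ≃ hE.characters, hE.IsCanonical θ ∧
      -- the semigroup structure carried over from `S` along the bijection
      (letI : Semigroup hE.characters := θ.symm.semigroup
       SeparatelyContinuousMul hE.characters ∧
        ∀ (s : hE.characters) (L : Set hE.characters), IsCompact L →
          IsCompact {t | s * t ∈ L} ∧ IsCompact {t | t * s ∈ L}) ∧
      -- the structure determines `E`
      ∀ (F : Submodule ℂ (HopfPredual.EllInf S)) (hF : HopfPredual.IsHopfPredual F)
        (φ : S ≃ hF.characters), hF.IsCanonical φ → IsHomeomorph (θ.symm.trans φ) → E = F := by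
  refine ⟨⟨{ hE.toSubalgebra with star_mem' := hE.star_mem }, rfl, hE.isClosed⟩, ?_⟩
  obtain ⟨θ, hθ⟩ := hE.exists_isCanonical
  exact ⟨θ, hθ, ⟨hθ.separatelyContinuousMul, fun s _ => hθ.isCompact_preimage_mul s⟩,
    fun _ _ _ hφ => hθ.eq_of_isHomeomorph hφ⟩
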